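/- Let $\mathbb D$ be the open unit disk, $A,B>0$, $\gamma\in(0,\pi)$, $n\ge 1$ an integer, and $$\varphi(z)=A\log\Big(\frac{1+z}{1-z}\Big)+\frac{Bz}{(1-e^{i\gamma}z)(1-e^{-i\gamma}z)},\qquad z\in\mathbb D,$$ where all logarithms are principal. A domain (nonempty, open and connected subset of $\mathbb C$) is called convex in the horizontal direction (CHD) if it meets each horizontal line in a connected or empty set. Then $\varphi$ maps $\mathbb D$ conformally onto a CHD domain. Let $f=h+\overline g$ be the harmonic shear of $\varphi$ with dilatation $\omega(z)=z^n$, that is $$h(z)=\int_0^z\frac{\varphi'(\zeta)}{1-\zeta^n}\,d\zeta,\qquad g(z)=\int_0^z\frac{\zeta^n\varphi'(\zeta)}{1-\zeta^n}\,d\zeta ,$$ with integration along the segment from $0$ to $z$. Then $h$ and $g$ are analytic in $\mathbb D$, $h(0)=g(0)=0$, and in $\mathbb D$ one has $h'-g'=\varphi'$, $g'=z^nh'$, $h'\neq0$ and $g=h-\varphi$. Moreover, with $z_k=e^{2\pi ik/n}$, $$h=2A\,I_1-\frac{B}{2\sin\gamma}\,i\,\big(e^{-i\gamma}I_2-e^{i\gamma}I_3\big)\quad\text{in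 }\mathbb D,$$ where $I_1,I_2,I_3$ are as follows. (1) Let $I_{1,0}=\frac12\frac{z}{1-z}+\frac14\log\frac{1+z}{1-z}$, $I_{1,n/2}=\frac12\frac{z}{1+z}+\frac14\log\frac{1+z}{1-z}$ (for $n$ even), and, when $z_k\ne\pm1$, $$I_{1,k}=-\frac{z_k\log(1-z)}{2(z_k-1)}+\frac{z_k\log(1+z)}{2(z_k+1)}+\frac{z_k}{z_k^2-1}\log\Big(\frac{z_k-z}{z_k}\Big).$$ If $n$ is odd, $I_1=\frac1n\big(I_{1,0}+\sum_{k=1}^{n-1}I_{1,k}\big)$ (the sum is empty for $n=1$); if $n$ is even, $I_1=\frac1n\big(I_{1,0}+I_{1,n/2}+\sum_{1\le k\le n-1,\,k\ne n/2}I_{1,k}\big)$. (2) For $|p|=1$ and $p\neq z_k$ let $$T_k(p)=z_k\left\{\frac1{p-z_k}\Big(\frac1{p-z}-\frac1p\Big)-\frac1{(p-z_k)^2}\Big[\log\Big(\frac{p-z}{p}\Big)-\log\Big(\frac{z_k-z}{z_k}\Big)\Big]\right\}.$$ If $\gamma\ne 2\pi m/n$ for all $m=0,\dots,n-1$, then $I_2=I_{e^{-i\gamma}}$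 and $I_3=I_{e^{i\gamma}}$, where $I_p=-\frac1n\sum_{k=0}^{n-1}T_k(p)$. If $\gamma=2\pi m/n$ for some $m\in\{0,\dots,n-1\}$, then $I_2=I_{3,n-m}$ and $I_3=I_{3,m}$, where $$I_{3,l}=-\frac1n\sum_{0\le k\le n-1,\,k\ne l}T_k(z_l)+\frac{z_l}{2n}\Big[\frac1{(z-z_l)^2}-\frac1{z_l^2}\Big].$$ Finally, $f$ is harmonic in $\mathbb D$ and maps $\mathbb D$ univalently onto a domain that is convex in the horizontal direction. -/

import Mathlib

open Complex Set
open scoped ComplexConjugate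

noncomputable section

/-- The open unit disk. -/
def unitDisk : Set ℂ := Metric.ball 0 1

/-- A domain (nonempty, open, connected) that is convex in the horizontal direction: it meets
every horizontal line in a connected or empty set. -/
def IsCHDDomain (D : Set ℂ) : Prop :=
  IsOpen D ∧ IsConnected D ∧ ∀ y : ℝ, IsPreconnected (D ∩ {w : ℂ | w.im = y})

/-- The four-slit map `A log((1+z)/(1-z)) + B z/((1-e^{iγ}z)(1-e^{-iγ}z))`. -/
def fourSlit (A B γ : ℝ) (z : ℂ) : ℂ :=
  A * log ((1 + z) / (1 - z)) + B * (z / ((1 - exp (I * γ) * z) * (1 - exp (-(I * γ)) * z)))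

/-- The integral `∫_0^z u(ζ) dζ` along the segment from `0` to `z`. -/
def segmentIntegral (u : ℂ → ℂ) (z : ℂ) : ℂ := ∫ t in (0 : ℝ)..1, u ((t : ℂ) * z) * z

/-- Analytic part of the harmonic shear of `φ` with dilatation `ω`: `∫_0^z φ'/(1-ω)`. -/
def shearH (φ ω : ℂ → ℂ) (z : ℂ) : ℂ :=
  segmentIntegral (fun ζ => deriv φ ζ / (1 - ω ζ)) z

/-- The function `g` of the harmonic shear of `φ` with dilatation `ω`: `∫_0^z ω φ'/(1-ω)`. -/
def shearG (φ ω : ℂ → ℂ) (z : ℂ) : ℂ :=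
  segmentIntegral (fun ζ => ω ζ * (deriv φ ζ / (1 - ω ζ))) z

/-- `h, g` are analytic in the unit disk, vanish at `0`, and solve there the shear equations
`h' - g' = φ'`, `ω h' - g' = 0`, with `h'` free of zeros (so that `g'/h' = ω`). -/
structure SolvesShearEquations (φ ω h g : ℂ → ℂ) : Prop where
  analytic_h : AnalyticOnNhd ℂ h unitDisk
  analytic_g : AnalyticOnNhd ℂ g unitDisk
  h_zero : h 0 = 0
  g_zero : g 0 = 0
  deriv_sub : ∀ z ∈ unitDisk, deriv h z - deriv g z = deriv φ z
  dilatation : ∀ z ∈ unitDisk, ω z * deriv h z - deriv g z = 0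
  deriv_ne_zero : ∀ z ∈ unitDisk, deriv h z ≠ 0

/-- The root of unity `z_k = e^{2πik/n}`. -/
def zRoot (n k : ℕ) : ℂ := exp (2 * Real.pi * I * k / n)

/-- `I_{1,0}`. -/
def IOneZero (z : ℂ) : ℂ := 1 / 2 * (z / (1 - z)) + 1 / 4 * log ((1 + z) / (1 - z))

/-- `I_{1,n/2}`, used for even `n`. -/
def IOneHalf (z : ℂ) : ℂ := 1 / 2 * (z / (1 + z)) + 1 / 4 * log ((1 + z) / (1 - z))

/-- `I_{1,k}`, used when `z_k ≠ ±1`. -/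
def IOneTerm (n k : ℕ) (z : ℂ) : ℂ :=
  -(zRoot n k * log (1 - z) / (2 * (zRoot n k - 1)))
    + zRoot n k * log (1 + z) / (2 * (zRoot n k + 1))
    + zRoot n k / (zRoot n k ^ 2 - 1) * log ((zRoot n k - z) / zRoot n k)

/-- `I_1`, according to the parity of `n`. -/
def IOne (n : ℕ) (z : ℂ) : ℂ :=
  if Even n then
    1 / n * (IOneZero z + IOneHalf z + ∑ k ∈ ((Finset.range n).erase 0).erase (n / 2),
      IOneTerm n k z)
  else
    1 / n * (IOneZero z + ∑ k ∈ (Finset.range n).erase 0, IOneTerm n k z)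

/-- The summand `∫_0^z z_k dζ/((ζ-p)^2 (ζ-z_k))`, for `|p| = 1`, `p ≠ z_k`, in closed form. -/
def doublePoleTerm (n k : ℕ) (p z : ℂ) : ℂ :=
  zRoot n k * (1 / (p - zRoot n k) * (1 / (p - z) - 1 / p)
    - 1 / (p - zRoot n k) ^ 2 * (log ((p - z) / p) - log ((zRoot n k - z) / zRoot n k)))

/-- The integral `I_p` for a unimodular `p` that is not an `n`-th root of unity. -/
def IPole (n : ℕ) (p z : ℂ) : ℂ :=
  -(1 / n * ∑ k ∈ Finset.range n, doublePoleTerm n k p z)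

/-- The integral `I_{3,m}`, for the double pole `z_m`. -/
def IRoot (n m : ℕ) (z : ℂ) : ℂ :=
  -(1 / n * ∑ k ∈ (Finset.range n).erase m, doublePoleTerm n k (zRoot n m) z)
    + zRoot n m / (2 * n) * (1 / (z - zRoot n m) ^ 2 - 1 / zRoot n m ^ 2)

/-- `2 A I_1 - (B / (2 sin γ)) i (e^{-iγ} I_2 - e^{iγ} I_3)`. -/
def combineH (A B γ : ℝ) (I₁ I₂ I₃ : ℂ) : ℂ :=
  2 * A * I₁ - B / (2 * Real.sin γ) * I * (exp (-(I * γ)) * I₂ - exp (I * γ) * I₃)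

end

/-! Write `a = e^{iγ}`, `b = e^{-iγ}`. The quotient `q = (1 - z²)/((1 - az)(1 - bz))` is the mean of
two half-plane maps, so `Re q > 0`, and `(1 - az)(1 - bz)φ' = 2A/q + Bq` also has positive real part
(`re_mul_deriv_fourSlit_pos`).

The substitution `(a - z)/(1 - az) = e^s` carries the disk to the strip `0 < Im s < π` and turns
this into `Im dφ/ds < 0`. Hence `φ` is injective by Noshiro-Warschawski, and `Im φ` decreases
strictly along horizontal lines of the strip. It takes every real value there, because its
non-logarithmic part grows like `sinh` while the logarithm has bounded imaginary part. So each level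
set of `Im φ` is a graph over `(0, π)`, which makes the image CHD (`isPreconnected_image_strip`).

The shear is `f = φ + 2 Re g`. On a horizontal segment of the image of `φ`, `f ∘ φ⁻¹` keeps the
imaginary part, and its real part has derivative `Re((1 + ω)/(1 - ω)) > 0`; thus univalence and CHD
pass to `f` (`injOn_and_preconnected_of_shear`).

The formula for `h` combines `n/(1 - zⁿ) = ∑ z_k/(z_k - z)` with the partial fractions of `φ'`: both
sides vanish at `0` and have the same derivative (`shearH_fourSlit_eq_combineH`). -/

/-! ### Primitives on the disk by integration along segments. -/

theorem isOpen_unitDisk : IsOpen unitDisk := Metric.isOpen_ball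

theorem convex_unitDisk : Convex ℝ unitDisk := convex_ball 0 1

theorem zero_mem_unitDisk : (0 : ℂ) ∈ unitDisk := Metric.mem_ball_self one_pos

theorem mem_unitDisk {z : ℂ} : z ∈ unitDisk ↔ ‖z‖ < 1 := mem_ball_zero_iff

theorem ofReal_mul_mem_unitDisk {z : ℂ} (hz : z ∈ unitDisk) {t : ℝ} (ht : t ∈ Icc (0 : ℝ) 1) :
    (t : ℂ) * z ∈ unitDisk := by
  rw [mem_unitDisk] at *
  rw [norm_mul, norm_real, Real.norm_of_nonneg ht.1]
  exact (mul_le_of_le_one_left (norm_nonneg z) ht.2).trans_lt hz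

theorem segmentIntegral_eq_sub {u F : ℂ → ℂ} (hF : ∀ z ∈ unitDisk, HasDerivAt F (u z) z)
    (hu : ContinuousOn u unitDisk) {z : ℂ} (hz : z ∈ unitDisk) :
    segmentIntegral u z = F z - F 0 := by
  have huIcc : uIcc (0 : ℝ) 1 = Icc 0 1 := uIcc_of_le zero_le_one
  have h := intervalIntegral.integral_eq_sub_of_hasDerivAt (a := 0) (b := 1)
    (f := fun t : ℝ => F (t * z)) (f' := fun t : ℝ => u (t * z) * z) ?_ ?_
  · simpa [segmentIntegral] using h
  · intro t ht
    have h1 : HasDerivAt (fun t : ℝ => (t : ℂ) * z) z t := by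
      simpa using (hasDerivAt_id t).ofReal_comp.mul_const z
    exact (hF _ (ofReal_mul_mem_unitDisk hz (huIcc ▸ ht))).comp t h1
  · apply ContinuousOn.intervalIntegrable
    refine (hu.comp (by fun_prop) fun t ht => ?_).mul continuousOn_const
    exact ofReal_mul_mem_unitDisk hz (huIcc ▸ ht)

/-- A holomorphic function on a disk has some primitive, and the segment integral differs from it by
a constant. -/
theorem hasDerivAt_segmentIntegral {u : ℂ → ℂ} (hu : DifferentiableOn ℂ u unitDisk) {z : ℂ}
    (hz : z ∈ unitDisk) : HasDerivAt (segmentIntegral u) (u z) z := by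
  obtain ⟨F, hF⟩ := hu.isExactOn_ball
  have h : segmentIntegral u =ᶠ[nhds z] fun w => F w - F 0 := by
    filter_upwards [isOpen_unitDisk.mem_nhds hz] with w hw
    exact segmentIntegral_eq_sub hF hu.continuousOn hw
  exact ((hF z hz).sub_const _).congr_of_eventuallyEq h

theorem segmentIntegral_zero (u : ℂ → ℂ) : segmentIntegral u 0 = 0 := by
  simp [segmentIntegral]

/-! ### The shear equations. -/

section Shear

variable {φ ω : ℂ → ℂ}

theorem one_sub_ne_zero_of_norm_lt_one {w : ℂ} (hw : ‖w‖ < 1) : 1 - w ≠ 0 := by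
  intro h
  rw [← sub_eq_zero.mp h] at hw
  simp at hw

theorem differentiableOn_deriv_div_one_sub (hφ : AnalyticOnNhd ℂ φ unitDisk)
    (hω : DifferentiableOn ℂ ω unitDisk) (hω1 : ∀ z ∈ unitDisk, ‖ω z‖ < 1) :
    DifferentiableOn ℂ (fun ζ => deriv φ ζ / (1 - ω ζ)) unitDisk :=
  hφ.deriv.differentiableOn.div (hω.const_sub 1) fun z hz =>
    one_sub_ne_zero_of_norm_lt_one (hω1 z hz)

theorem hasDerivAt_shearH (hφ : AnalyticOnNhd ℂ φ unitDisk)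
    (hω : DifferentiableOn ℂ ω unitDisk) (hω1 : ∀ z ∈ unitDisk, ‖ω z‖ < 1) {z : ℂ}
    (hz : z ∈ unitDisk) : HasDerivAt (shearH φ ω) (deriv φ z / (1 - ω z)) z :=
  hasDerivAt_segmentIntegral (differentiableOn_deriv_div_one_sub hφ hω hω1) hz

theorem hasDerivAt_shearG (hφ : AnalyticOnNhd ℂ φ unitDisk)
    (hω : DifferentiableOn ℂ ω unitDisk) (hω1 : ∀ z ∈ unitDisk, ‖ω z‖ < 1) {z : ℂ}
    (hz : z ∈ unitDisk) : HasDerivAt (shearG φ ω) (ω z * (deriv φ z / (1 - ω z))) z :=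
  hasDerivAt_segmentIntegral (hω.mul (differentiableOn_deriv_div_one_sub hφ hω hω1)) hz

theorem solvesShearEquations_shear (hφ : AnalyticOnNhd ℂ φ unitDisk)
    (hφ' : ∀ z ∈ unitDisk, deriv φ z ≠ 0)
    (hω : DifferentiableOn ℂ ω unitDisk) (hω1 : ∀ z ∈ unitDisk, ‖ω z‖ < 1) :
    SolvesShearEquations φ ω (shearH φ ω) (shearG φ ω) where
  analytic_h := DifferentiableOn.analyticOnNhd
    (fun z hz => (hasDerivAt_shearH hφ hω hω1 hz).differentiableAt.differentiableWithinAt)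
    isOpen_unitDisk
  analytic_g := DifferentiableOn.analyticOnNhd
    (fun z hz => (hasDerivAt_shearG hφ hω hω1 hz).differentiableAt.differentiableWithinAt)
    isOpen_unitDisk
  h_zero := segmentIntegral_zero _
  g_zero := segmentIntegral_zero _
  deriv_sub z hz := by
    have := one_sub_ne_zero_of_norm_lt_one (hω1 z hz)
    rw [(hasDerivAt_shearH hφ hω hω1 hz).deriv, (hasDerivAt_shearG hφ hω hω1 hz).deriv]
    field_simp
  dilatation z hz := by
    rw [(hasDerivAt_shearH hφ hω hω1 hz).deriv, (hasDerivAt_shearG hφ hω hω1 hz).deriv, sub_self]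
  deriv_ne_zero z hz := by
    rw [(hasDerivAt_shearH hφ hω hω1 hz).deriv]
    exact div_ne_zero (hφ' z hz) (one_sub_ne_zero_of_norm_lt_one (hω1 z hz))

theorem shearH_sub_shearG (hφ : AnalyticOnNhd ℂ φ unitDisk) (hφ0 : φ 0 = 0)
    (hω : DifferentiableOn ℂ ω unitDisk) (hω1 : ∀ z ∈ unitDisk, ‖ω z‖ < 1) {z : ℂ}
    (hz : z ∈ unitDisk) : shearH φ ω z - shearG φ ω z = φ z := by
  have h1 : segmentIntegral (deriv φ) z = shearH φ ω z - shearG φ ω z := by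
    rw [segmentIntegral_eq_sub (F := fun z => shearH φ ω z - shearG φ ω z) _
      hφ.deriv.continuousOn hz]
    · simp [shearH, shearG, segmentIntegral_zero]
    · intro w hw
      refine ((hasDerivAt_shearH hφ hω hω1 hw).sub (hasDerivAt_shearG hφ hω hω1 hw)).congr_deriv ?_
      have := one_sub_ne_zero_of_norm_lt_one (hω1 w hw)
      field_simp
  rw [← h1, segmentIntegral_eq_sub (F := φ) (fun w hw => (hφ w hw).differentiableAt.hasDerivAt)
    hφ.deriv.continuousOn hz, hφ0, sub_zero]

end Shear

/-! ### Univalence, openness and harmonicity of shears. -/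

section ShearUnivalence

variable {φ h g f : ℂ → ℂ}

theorem re_one_add_div_one_sub_pos {w : ℂ} (hw : ‖w‖ < 1) : 0 < ((1 + w) / (1 - w)).re := by
  have h1 : 0 < normSq (1 - w) := normSq_pos.mpr (one_sub_ne_zero_of_norm_lt_one hw)
  have h2 : normSq w < 1 := by
    rw [normSq_eq_norm_sq]
    nlinarith [norm_nonneg w]
  rw [normSq_apply] at h2
  rw [div_re, ← add_div]
  apply div_pos _ h1
  simp only [add_re, one_re, sub_re, add_im, one_im, sub_im]
  nlinarith

/-- Clunie and Sheil-Small: a function `f` with `f = φ + 2 Re g` inherits univalence and convexity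
in the horizontal direction from `φ`, if `g' = ω h'`, `h - g = φ` with `|ω| < 1`. -/
theorem injOn_and_preconnected_of_shear {ω : ℂ → ℂ} {D : Set ℂ} (hD : IsOpen D)
    (hφ : AnalyticOnNhd ℂ φ D) (hφ' : ∀ z ∈ D, deriv φ z ≠ 0) (hinj : InjOn φ D)
    (hCHD : ∀ y : ℝ, IsPreconnected (φ '' D ∩ {w : ℂ | w.im = y}))
    (hω1 : ∀ z ∈ D, ‖ω z‖ < 1)
    (hg : ∀ z ∈ D, HasDerivAt g (ω z * (deriv φ z / (1 - ω z))) z)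
    (hf : ∀ z ∈ D, f z = φ z + (2 * (g z).re : ℝ)) :
    InjOn f D ∧ ∀ y : ℝ, IsPreconnected (f '' D ∩ {w : ℂ | w.im = y}) := by
  set ψ : ℂ → ℂ := Function.invFunOn φ D with hψ
  have hψφ : ∀ z ∈ D, ψ (φ z) = z := fun z hz => hinj.leftInvOn_invFunOn hz
  have him : ∀ z ∈ D, (f z).im = (φ z).im := fun z hz => by rw [hf z hz, add_im, ofReal_im, add_zero]
  -- the derivative of `F = f ∘ φ⁻¹` along horizontal lines
  have hder : ∀ (y x : ℝ), (x + y * I : ℂ) ∈ φ '' D →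
      HasDerivAt (fun x : ℝ => x + 2 * (g (ψ (x + y * I))).re)
        ((1 + ω (ψ (x + y * I))) / (1 - ω (ψ (x + y * I)))).re x := by
    rintro y x ⟨z, hz, hzx⟩
    -- `ψ` is only a set-theoretic inverse; since `φ'` does not vanish, being a left inverse near
    -- `z` already makes it differentiable.
    have hs := (hφ z hz).hasStrictDerivAt.to_local_left_inverse (hφ' z hz) (g := ψ)
      (by filter_upwards [hD.mem_nhds hz] with w hw using hψφ w hw)
    have hg1 : HasDerivAt g (ω z * (deriv φ z / (1 - ω z))) (ψ (φ z)) := by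
      rw [hψφ z hz]; exact hg z hz
    have h2 := hg1.comp (φ z) hs.hasDerivAt
    rw [hzx] at h2
    have hl : HasDerivAt (fun x : ℂ => x + y * I) 1 (x : ℂ) := (hasDerivAt_id _).add_const _
    have h3 := (HasDerivAt.comp (x : ℂ) h2 hl).real_of_complex
    refine ((hasDerivAt_id x).add (h3.const_mul 2)).congr_deriv ?_
    rw [← hzx, hψφ z hz]
    have h4 := hφ' z hz
    have h5 := one_sub_ne_zero_of_norm_lt_one (hω1 z hz)
    -- The factor `φ'` from `g'` cancels against the derivative of `φ⁻¹`, leaving a function of `ω`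
    -- alone.
    have h6 : (1 + ω z) / (1 - ω z)
        = 1 + (2 : ℝ) * (ω z * (deriv φ z / (1 - ω z)) * (deriv φ z)⁻¹ * 1) := by
      push_cast
      field_simp
      ring
    rw [h6, add_re, one_re, re_ofReal_mul]
  have hconv : ∀ y : ℝ, OrdConnected {x : ℝ | (x + y * I : ℂ) ∈ φ '' D} := by
    intro y
    have h1 : {x : ℝ | (x + y * I : ℂ) ∈ φ '' D} = re '' (φ '' D ∩ {w : ℂ | w.im = y}) := by
      ext x
      constructor
      · intro hx
        exact ⟨_, ⟨hx, by simp⟩, by simp⟩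
      · rintro ⟨w, ⟨hw, hwy⟩, rfl⟩
        have : (w.re + y * I : ℂ) = w := by rw [← show w.im = y from hwy, re_add_im]
        simpa [this] using hw
    rw [h1]
    exact ((hCHD y).image re continuous_re.continuousOn).ordConnected
  have hmono : ∀ y : ℝ, StrictMonoOn (fun x : ℝ => x + 2 * (g (ψ (x + y * I))).re)
      {x : ℝ | (x + y * I : ℂ) ∈ φ '' D} := by
    intro y
    apply strictMonoOn_of_deriv_pos (hconv y).convex
    · exact fun x hx => (hder y x hx).continuousAt.continuousWithinAt
    · intro x hx
      have hx := interior_subset hx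
      rw [(hder y x hx).deriv]
      obtain ⟨z, hz, hzx⟩ := hx
      rw [← hzx, hψφ z hz]
      exact re_one_add_div_one_sub_pos (hω1 z hz)
  have hfφ : ∀ z ∈ D, f z = ((φ z).re + 2 * (g (ψ ((φ z).re + (φ z).im * I))).re : ℝ)
      + (φ z).im * I := by
    intro z hz
    rw [re_add_im, hψφ z hz, hf z hz]
    conv_lhs => rw [← re_add_im (φ z)]
    push_cast
    ring
  refine ⟨fun z hz w hw hzw => ?_, fun y => ?_⟩
  · apply hinj hz hw
    have h1 : (φ z).im = (φ w).im := by rw [← him z hz, ← him w hw, hzw]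
    refine Complex.ext ?_ h1
    apply (hmono (φ w).im).injOn
    · rw [mem_ofPred_eq, ← h1, re_add_im]; exact mem_image_of_mem _ hz
    · rw [mem_ofPred_eq, re_add_im]; exact mem_image_of_mem _ hw
    · have h2 := congrArg re (hfφ z hz)
      have h3 := congrArg re (hfφ w hw)
      rw [hzw, h3, h1] at h2
      simpa using h2.symm
  · have h1 : f '' D ∩ {w : ℂ | w.im = y} =
        (fun x : ℝ => ((x + 2 * (g (ψ (x + y * I))).re : ℝ) : ℂ) + y * I) ''
          {x : ℝ | (x + y * I : ℂ) ∈ φ '' D} := by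
      ext w
      constructor
      · rintro ⟨⟨z, hz, rfl⟩, hy⟩
        have hy' : (φ z).im = y := by rw [← him z hz]; exact hy
        refine ⟨(φ z).re, ?_, ?_⟩
        · rw [mem_ofPred_eq, ← hy', re_add_im]; exact mem_image_of_mem _ hz
        · simp only
          rw [hfφ z hz, hy']
      · rintro ⟨x, ⟨z, hz, hzx⟩, rfl⟩
        refine ⟨⟨z, hz, ?_⟩, by simp⟩
        rw [hfφ z hz, hzx]
        simp
    rw [h1]
    refine ((hconv y).isPreconnected).image _ fun x hx => ?_
    have := (hder y x hx).continuousAt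
    exact ((continuous_ofReal.continuousAt.comp this).add continuousAt_const).continuousWithinAt

/-- The real differential `w ↦ h' w + conj (g' w)` is invertible: a nonzero kernel vector would
force `|h'| = |g'|`. With `g = 0` this also gives openness of the image of `φ`. -/
theorem isOpen_image_add_conj {D : Set ℂ} (hD : IsOpen D)
    (hh : AnalyticOnNhd ℂ h D) (hg : AnalyticOnNhd ℂ g D)
    (hlt : ∀ z ∈ D, ‖deriv g z‖ < ‖deriv h z‖) :
    IsOpen ((fun z => h z + conj (g z)) '' D) := by
  rw [isOpen_iff_mem_nhds]
  rintro _ ⟨z, hz, rfl⟩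
  have h1 := ((hh z hz).hasStrictDerivAt.hasStrictFDerivAt.restrictScalars ℝ).add
    (conjCLE.toContinuousLinearMap.hasStrictFDerivAt.comp z
      ((hg z hz).hasStrictDerivAt.hasStrictFDerivAt.restrictScalars ℝ))
  have h2 := h1.map_nhds_eq_of_surj (LinearMap.range_eq_top.mpr ?_)
  · refine Filter.mem_of_superset (h2 ▸ Filter.image_mem_map (hD.mem_nhds hz)) ?_
    exact subset_rfl
  · refine LinearMap.injective_iff_surjective.mp ?_
    rw [injective_iff_map_eq_zero]
    intro w hw
    have h3 : w * deriv h z + conj (w * deriv g z) = 0 := by simpa using hw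
    by_contra hw0
    have h4 := congrArg norm (eq_neg_of_add_eq_zero_left h3)
    rw [norm_neg, RCLike.norm_conj, norm_mul, norm_mul] at h4
    exact (hlt z hz).ne (mul_left_cancel₀ (norm_ne_zero_iff.mpr hw0) h4).symm

theorem harmonicOnNhd_add_conj {D : Set ℂ} (hh : AnalyticOnNhd ℂ h D) (hg : AnalyticOnNhd ℂ g D) :
    InnerProductSpace.HarmonicOnNhd (fun z => h z + conj (g z)) D := fun z hz =>
  ((hh z hz).harmonicAt).add (((hg z hz).harmonicAt).comp_CLM conjCLE.toContinuousLinearMap)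

end ShearUnivalence

/-! ### The four-slit map and the sign of its derivative. -/

section FourSlit

theorem exp_I_mul_mul_exp_neg (γ : ℝ) : exp (I * γ) * exp (-(I * γ)) = 1 := by
  rw [← Complex.exp_add, add_neg_cancel, Complex.exp_zero]

theorem norm_exp_I_mul (γ : ℝ) : ‖exp (I * γ)‖ = 1 := by
  rw [mul_comm]; exact norm_exp_ofReal_mul_I γ

theorem norm_exp_neg_I_mul (γ : ℝ) : ‖exp (-(I * γ))‖ = 1 := by
  rw [Complex.exp_neg, norm_inv, norm_exp_I_mul, inv_one]

theorem exp_I_mul_sub_exp_neg (γ : ℝ) :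
    exp (I * γ) - exp (-(I * γ)) = 2 * I * (Real.sin γ : ℂ) := by
  rw [ofReal_sin, Complex.sin, mul_comm I]
  rw [show -(γ * I : ℂ) = -γ * I by ring]
  linear_combination (-(exp (-γ * I) - exp (γ * I))) * I_sq

theorem norm_mul_lt_one {a z : ℂ} (ha : ‖a‖ = 1) (hz : z ∈ unitDisk) : ‖a * z‖ < 1 := by
  rwa [norm_mul, ha, one_mul, ← mem_unitDisk]

theorem one_sub_mul_ne_zero {a z : ℂ} (ha : ‖a‖ = 1) (hz : z ∈ unitDisk) : 1 - a * z ≠ 0 :=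
  one_sub_ne_zero_of_norm_lt_one (norm_mul_lt_one ha hz)

theorem sub_ne_zero_of_mem_unitDisk {p z : ℂ} (hp : ‖p‖ = 1) (hz : z ∈ unitDisk) : p - z ≠ 0 := by
  intro h
  rw [mem_unitDisk, ← sub_eq_zero.mp h, hp] at hz
  exact lt_irrefl _ hz

theorem one_sub_ne_zero {z : ℂ} (hz : z ∈ unitDisk) : 1 - z ≠ 0 :=
  sub_ne_zero_of_mem_unitDisk norm_one hz

theorem one_add_ne_zero {z : ℂ} (hz : z ∈ unitDisk) : 1 + z ≠ 0 := by
  have := one_sub_mul_ne_zero (a := -1) (by simp) hz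
  simpa using this

theorem one_sub_sq_ne_zero {z : ℂ} (hz : z ∈ unitDisk) : 1 - z ^ 2 ≠ 0 := by
  rw [show 1 - z ^ 2 = (1 - z) * (1 + z) by ring]
  exact mul_ne_zero (one_sub_ne_zero hz) (one_add_ne_zero hz)

theorem hasDerivAt_log_one_add_div_one_sub {z : ℂ} (hz : z ∈ unitDisk) :
    HasDerivAt (fun z => log ((1 + z) / (1 - z))) (2 / (1 - z ^ 2)) z := by
  have h1 := one_sub_ne_zero hz
  have h2 := one_add_ne_zero hz
  have h3 := one_sub_sq_ne_zero hz
  have h4 : (1 + z) / (1 - z) ∈ slitPlane :=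
    Or.inl (re_one_add_div_one_sub_pos (mem_unitDisk.mp hz))
  refine ((((hasDerivAt_id z).const_add 1).div ((hasDerivAt_id z).const_sub 1) h1).clog
    h4).congr_deriv ?_
  simp only [id, Pi.div_apply]
  field_simp
  ring

theorem hasDerivAt_fourSlit (A B γ : ℝ) {z : ℂ} (hz : z ∈ unitDisk) :
    HasDerivAt (fourSlit A B γ) (2 * A / (1 - z ^ 2) + B * ((1 - z ^ 2) /
      ((1 - exp (I * γ) * z) * (1 - exp (-(I * γ)) * z)) ^ 2)) z := by
  have hab := exp_I_mul_mul_exp_neg γ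
  have h1 := one_sub_mul_ne_zero (norm_exp_I_mul γ) hz
  have h2 := one_sub_mul_ne_zero (norm_exp_neg_I_mul γ) hz
  have h3 := one_sub_sq_ne_zero hz
  unfold fourSlit
  set a := exp (I * γ)
  set b := exp (-(I * γ))
  have hl (c : ℂ) : HasDerivAt (fun z => 1 - c * z) (-c) z := by
    simpa using ((hasDerivAt_id z).const_mul c).const_sub 1
  refine (((hasDerivAt_log_one_add_div_one_sub hz).const_mul (A : ℂ)).add
    (((hasDerivAt_id z).div ((hl a).mul (hl b)) (mul_ne_zero h1 h2)).const_mul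
      (B : ℂ))).congr_deriv ?_
  simp only [id]
  congr 1
  · ring
  · congr 1
    simp only [Pi.mul_apply]
    congr 1
    linear_combination z ^ 2 * (-hab)

theorem analyticOnNhd_fourSlit (A B γ : ℝ) : AnalyticOnNhd ℂ (fourSlit A B γ) unitDisk :=
  DifferentiableOn.analyticOnNhd (fun _ hz =>
    (hasDerivAt_fourSlit A B γ hz).differentiableAt.differentiableWithinAt) isOpen_unitDisk

theorem fourSlit_zero (A B γ : ℝ) : fourSlit A B γ 0 = 0 := by simp [fourSlit]

theorem re_inv_pos {w : ℂ} (hw : 0 < w.re) : 0 < (w⁻¹).re := by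
  rw [inv_re]
  exact div_pos hw (normSq_pos.mpr fun h => by simp [h] at hw)

theorem re_mul_deriv_fourSlit_pos {A B : ℝ} (hA : 0 < A) (hB : 0 < B) (γ : ℝ) {z : ℂ}
    (hz : z ∈ unitDisk) :
    0 < ((1 - exp (I * γ) * z) * (1 - exp (-(I * γ)) * z) * deriv (fourSlit A B γ) z).re := by
  rw [(hasDerivAt_fourSlit A B γ hz).deriv]
  have hab := exp_I_mul_mul_exp_neg γ
  have h1 := one_sub_mul_ne_zero (norm_exp_I_mul γ) hz
  have h2 := one_sub_mul_ne_zero (norm_exp_neg_I_mul γ) hz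
  have h3 := one_sub_sq_ne_zero hz
  have h4 := re_one_add_div_one_sub_pos (norm_mul_lt_one (norm_exp_I_mul γ) hz)
  have h5 := re_one_add_div_one_sub_pos (norm_mul_lt_one (norm_exp_neg_I_mul γ) hz)
  set a := exp (I * γ)
  set b := exp (-(I * γ))
  have h2' : 1 - z * b ≠ 0 := by rwa [mul_comm]
  -- Since `ab = 1`, the cross terms of the two half-plane maps cancel in the sum.
  have hq : (1 - z ^ 2) / ((1 - a * z) * (1 - b * z))
      = (1 / 2 : ℝ) * ((1 + a * z) / (1 - a * z) + (1 + b * z) / (1 - b * z)) := by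
    rw [div_add_div _ _ h1 h2, ← mul_div_assoc]
    congr 1
    push_cast
    linear_combination z ^ 2 * hab
  have hq0 : 0 < ((1 - z ^ 2) / ((1 - a * z) * (1 - b * z))).re := by
    rw [hq, re_ofReal_mul, add_re]
    positivity
  have h6 : (1 - a * z) * (1 - b * z) * (2 * A / (1 - z ^ 2) + B * ((1 - z ^ 2) /
      ((1 - a * z) * (1 - b * z)) ^ 2))
      = (2 * A : ℝ) * ((1 - z ^ 2) / ((1 - a * z) * (1 - b * z)))⁻¹
        + (B : ℝ) * ((1 - z ^ 2) / ((1 - a * z) * (1 - b * z))) := by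
    push_cast
    field_simp
  have h7 := re_inv_pos hq0
  rw [h6, add_re, re_ofReal_mul, re_ofReal_mul]
  positivity

theorem deriv_fourSlit_ne_zero {A B : ℝ} (hA : 0 < A) (hB : 0 < B) (γ : ℝ) {z : ℂ}
    (hz : z ∈ unitDisk) : deriv (fourSlit A B γ) z ≠ 0 := by
  intro h
  have := re_mul_deriv_fourSlit_pos hA hB γ hz
  simp [h] at this

end FourSlit

/-! ### Roots of unity and the partial fractions of `1/(1 - zⁿ)`. -/

section RootsOfUnity

variable {n : ℕ}

theorem zRoot_eq_pow (n k : ℕ) : zRoot n k = exp (2 * Real.pi * I / n) ^ k := by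
  rw [zRoot, ← Complex.exp_nat_mul]
  congr 1
  ring

theorem zRoot_zero (n : ℕ) : zRoot n 0 = 1 := by simp [zRoot]

theorem norm_zRoot (n k : ℕ) : ‖zRoot n k‖ = 1 := by
  rw [zRoot, show (2 * Real.pi * I * k / n : ℂ) = ((2 * Real.pi * k / n : ℝ) : ℂ) * I by
    push_cast; ring]
  exact norm_exp_ofReal_mul_I _

theorem zRoot_ne_zero (n k : ℕ) : zRoot n k ≠ 0 := exp_ne_zero _

theorem zRoot_injOn (hn : n ≠ 0) {j k : ℕ} (hj : j < n) (hk : k < n) (h : zRoot n j = zRoot n k) :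
    j = k := by
  rw [zRoot_eq_pow, zRoot_eq_pow] at h
  exact (isPrimitiveRoot_exp n hn).pow_inj hj hk h

theorem zRoot_half (hn : n ≠ 0) (he : Even n) : zRoot n (n / 2) = -1 := by
  obtain ⟨m, rfl⟩ := he
  have hm : (m : ℂ) ≠ 0 := by
    norm_cast; omega
  rw [zRoot, show (m + m) / 2 = m by omega, ← exp_pi_mul_I]
  congr 1
  push_cast
  field_simp
  ring

theorem zRoot_pow (hn : n ≠ 0) (k : ℕ) : zRoot n k ^ n = 1 := by
  rw [zRoot_eq_pow, ← pow_mul, mul_comm k n, pow_mul, (isPrimitiveRoot_exp n hn).pow_eq_one, one_pow]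

theorem zRoot_ne_neg_one (hn : Odd n) (k : ℕ) : zRoot n k ≠ -1 := by
  intro h
  have h1 := zRoot_pow hn.pos.ne' k
  rw [h, hn.neg_one_pow] at h1
  norm_num at h1

theorem one_sub_pow_ne_zero (hn : n ≠ 0) {z : ℂ} (hz : z ∈ unitDisk) : 1 - z ^ n ≠ 0 := by
  apply one_sub_ne_zero_of_norm_lt_one
  rw [norm_pow]
  exact pow_lt_one₀ (norm_nonneg z) (mem_unitDisk.mp hz) hn

/-- As `(z/z_k)ⁿ = zⁿ`, each summand is a geometric sum of `n` terms over `1 - zⁿ`. Summing over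
`k`, orthogonality of the roots of unity kills every power except `j = 0`. -/
theorem sum_zRoot_div_sub (hn : n ≠ 0) {z : ℂ} (hz : z ∈ unitDisk) :
    ∑ k ∈ Finset.range n, zRoot n k / (zRoot n k - z) = n / (1 - z ^ n) := by
  have h0 := one_sub_pow_ne_zero hn hz
  have hprim := isPrimitiveRoot_exp n hn
  have h1 : ∀ k ∈ Finset.range n, zRoot n k / (zRoot n k - z)
      = (∑ j ∈ Finset.range n, z ^ j * ((exp (2 * Real.pi * I / n))⁻¹ ^ j) ^ k) / (1 - z ^ n) := by
    intro k _
    have h2 := sub_ne_zero_of_mem_unitDisk (norm_zRoot n k) hz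
    have h3 := zRoot_ne_zero n k
    have h4 : ∀ j ∈ Finset.range n, z ^ j * ((exp (2 * Real.pi * I / n))⁻¹ ^ j) ^ k
        = (z / zRoot n k) ^ j := by
      intro j _
      rw [zRoot_eq_pow, div_pow, ← pow_mul, ← pow_mul, inv_pow, mul_comm j k]
      exact (div_eq_mul_inv _ _).symm
    rw [Finset.sum_congr rfl h4, div_eq_div_iff h2 h0]
    have h5 := mul_neg_geom_sum (z / zRoot n k) n
    rw [div_pow z, zRoot_pow hn, div_one] at h5
    rw [← h5]
    field_simp
  rw [Finset.sum_congr rfl h1, ← Finset.sum_div, Finset.sum_comm]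
  congr 1
  rw [Finset.sum_eq_single_of_mem 0 (Finset.mem_range.mpr (Nat.pos_of_ne_zero hn))]
  · simp
  · intro j hj hj0
    rw [← Finset.mul_sum]
    have h6 : (exp (2 * Real.pi * I / n))⁻¹ ^ j ≠ 1 :=
      hprim.inv.pow_ne_one_of_pos_of_lt hj0 (Finset.mem_range.mp hj)
    have h7 := mul_neg_geom_sum ((exp (2 * Real.pi * I / n))⁻¹ ^ j) n
    rw [← pow_mul, mul_comm j n, pow_mul, hprim.inv.pow_eq_one, one_pow, sub_self,
      mul_eq_zero, sub_eq_zero] at h7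
    rw [h7.resolve_left (Ne.symm h6), mul_zero]

end RootsOfUnity

/-! ### Closed-form antiderivatives and the formula for `h`. -/

section Antiderivatives

variable {n : ℕ}

/-- Dividing by `p` puts the argument `1 - z/p` in the right half-plane, away from the cut of the
principal logarithm. -/
theorem hasDerivAt_log_sub_div {p z : ℂ} (hp : ‖p‖ = 1) (hz : z ∈ unitDisk) :
    HasDerivAt (fun z => log ((p - z) / p)) (-1 / (p - z)) z := by
  have hp0 : p ≠ 0 := norm_ne_zero_iff.mp (by rw [hp]; exact one_ne_zero)
  have h1 := sub_ne_zero_of_mem_unitDisk hp hz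
  refine ((((hasDerivAt_id z).const_sub p).div_const p).clog ?_).congr_deriv ?_
  · left
    have h2 : (z / p).re < 1 := by
      refine (re_le_norm _).trans_lt ?_
      rwa [norm_div, hp, div_one, ← mem_unitDisk]
    rw [sub_div, div_self hp0, sub_re, one_re]
    simpa using h2
  · simp only [id]
    field_simp

theorem hasDerivAt_log_one_sub {z : ℂ} (hz : z ∈ unitDisk) :
    HasDerivAt (fun z => log (1 - z)) (-1 / (1 - z)) z := by
  simpa using hasDerivAt_log_sub_div norm_one hz

theorem hasDerivAt_log_one_add {z : ℂ} (hz : z ∈ unitDisk) :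
    HasDerivAt (fun z => log (1 + z)) (1 / (1 + z)) z := by
  have h := hasDerivAt_log_sub_div (p := -1) (by simp) hz
  have h1 : (fun z : ℂ => log ((-1 - z) / -1)) = fun z => log (1 + z) := by
    ext z; congr 1; ring
  rw [h1] at h
  refine h.congr_deriv ?_
  rw [← neg_div_neg_eq]
  ring

theorem hasDerivAt_IOneZero {z : ℂ} (hz : z ∈ unitDisk) :
    HasDerivAt IOneZero (1 / (1 - z ^ 2) * (1 / (1 - z))) z := by
  have h1 := one_sub_ne_zero hz
  have h2 := one_add_ne_zero hz
  unfold IOneZero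
  refine ((((hasDerivAt_id z).div ((hasDerivAt_id z).const_sub 1) h1).const_mul (1 / 2 : ℂ)).add
    ((hasDerivAt_log_one_add_div_one_sub hz).const_mul (1 / 4 : ℂ))).congr_deriv ?_
  rw [show 1 - z ^ 2 = (1 - z) * (1 + z) by ring]
  simp only [id]
  field_simp
  ring

theorem hasDerivAt_IOneHalf {z : ℂ} (hz : z ∈ unitDisk) :
    HasDerivAt IOneHalf (1 / (1 - z ^ 2) * (-1 / (-1 - z))) z := by
  have h1 := one_sub_ne_zero hz
  have h2 := one_add_ne_zero hz
  unfold IOneHalf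
  refine ((((hasDerivAt_id z).div ((hasDerivAt_id z).const_add 1) h2).const_mul (1 / 2 : ℂ)).add
    ((hasDerivAt_log_one_add_div_one_sub hz).const_mul (1 / 4 : ℂ))).congr_deriv ?_
  rw [show 1 - z ^ 2 = (1 - z) * (1 + z) by ring, show -1 - z = -(1 + z) by ring]
  simp only [id]
  field_simp
  ring

theorem hasDerivAt_IOneTerm {k : ℕ} (hk : zRoot n k ≠ 1) (hk' : zRoot n k ≠ -1) {z : ℂ}
    (hz : z ∈ unitDisk) :
    HasDerivAt (IOneTerm n k) (1 / (1 - z ^ 2) * (zRoot n k / (zRoot n k - z))) z := by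
  have h1 := one_sub_ne_zero hz
  have h2 := one_add_ne_zero hz
  have h3 := sub_ne_zero_of_mem_unitDisk (norm_zRoot n k) hz
  have h4 : zRoot n k - 1 ≠ 0 := sub_ne_zero.mpr hk
  have h5 : zRoot n k + 1 ≠ 0 := fun h => hk' (eq_neg_of_add_eq_zero_left h)
  unfold IOneTerm
  refine (((((hasDerivAt_log_one_sub hz).const_mul (zRoot n k)).div_const _).neg.add
    (((hasDerivAt_log_one_add hz).const_mul (zRoot n k)).div_const _)).add
    ((hasDerivAt_log_sub_div (norm_zRoot n k) hz).const_mul _)).congr_deriv ?_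
  rw [show 1 - z ^ 2 = (1 - z) * (1 + z) by ring,
    show zRoot n k ^ 2 - 1 = (zRoot n k - 1) * (zRoot n k + 1) by ring]
  field_simp
  ring

/-- Parity enters because `z_k = ±1` collides with a pole of `1/(1 - z²)`: always at `k = 0`, and at
`k = n/2` exactly when `n` is even. -/
theorem hasDerivAt_IOne (hn : n ≠ 0) {z : ℂ} (hz : z ∈ unitDisk) :
    HasDerivAt (IOne n) (1 / (1 - z ^ 2) * (1 / (1 - z ^ n))) z := by
  have hn0 : (n : ℂ) ≠ 0 := Nat.cast_ne_zero.mpr hn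
  have hnpos := Nat.pos_of_ne_zero hn
  have h0 := one_sub_pow_ne_zero hn hz
  have hsum := sum_zRoot_div_sub hn hz
  have hmem : 0 ∈ Finset.range n := Finset.mem_range.mpr hnpos
  rw [← Finset.add_sum_erase _ _ hmem, zRoot_zero] at hsum
  have hone : ∀ k ∈ (Finset.range n).erase 0, zRoot n k ≠ 1 := by
    intro k hk h
    rw [Finset.mem_erase, Finset.mem_range] at hk
    exact hk.1 (zRoot_injOn hn hk.2 hnpos (h.trans (zRoot_zero n).symm))
  unfold IOne
  split_ifs with he
  · have hmem' : n / 2 ∈ (Finset.range n).erase 0 := by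
      obtain ⟨m, rfl⟩ := he
      rw [Finset.mem_erase, Finset.mem_range]
      omega
    rw [← Finset.add_sum_erase _ _ hmem', zRoot_half hn he] at hsum
    refine ((((hasDerivAt_IOneZero hz).add (hasDerivAt_IOneHalf hz)).add
      (HasDerivAt.fun_sum (u := ((Finset.range n).erase 0).erase (n / 2)) fun k hk =>
        hasDerivAt_IOneTerm (n := n) (k := k) (hone k (Finset.mem_of_mem_erase hk)) ?_
          hz)).const_mul (1 / n : ℂ)).congr_deriv ?_
    · intro h
      have h1 := Finset.mem_range.mp (Finset.mem_of_mem_erase (Finset.mem_of_mem_erase hk))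
      exact Finset.ne_of_mem_erase hk (zRoot_injOn hn h1 (Nat.div_lt_self hnpos one_lt_two)
        (h.trans (zRoot_half hn he).symm))
    · rw [← Finset.mul_sum, ← mul_add, ← mul_add, add_assoc, hsum]
      field_simp
  · rw [Nat.not_even_iff_odd] at he
    refine (((hasDerivAt_IOneZero hz).add
      (HasDerivAt.fun_sum (u := (Finset.range n).erase 0) fun k hk =>
        hasDerivAt_IOneTerm (n := n) (k := k) (hone k hk) (zRoot_ne_neg_one he k)
          hz)).const_mul (1 / n : ℂ)).congr_deriv ?_
    rw [← Finset.mul_sum, ← mul_add, hsum]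
    field_simp

theorem hasDerivAt_doublePoleTerm {k : ℕ} {p : ℂ} (hp : ‖p‖ = 1) (hk : p ≠ zRoot n k) {z : ℂ}
    (hz : z ∈ unitDisk) :
    HasDerivAt (doublePoleTerm n k p)
      (-(1 / (p - z) ^ 2 * (zRoot n k / (zRoot n k - z)))) z := by
  have h1 := sub_ne_zero_of_mem_unitDisk hp hz
  have h2 := sub_ne_zero_of_mem_unitDisk (norm_zRoot n k) hz
  have h3 : p - zRoot n k ≠ 0 := sub_ne_zero.mpr hk
  unfold doublePoleTerm
  refine (((((((hasDerivAt_const z (1 : ℂ)).div ((hasDerivAt_id z).const_sub p) h1).sub_const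
    (1 / p)).const_mul (1 / (p - zRoot n k))).sub (((hasDerivAt_log_sub_div hp hz).sub
      (hasDerivAt_log_sub_div (norm_zRoot n k) hz)).const_mul
        (1 / (p - zRoot n k) ^ 2)))).const_mul (zRoot n k)).congr_deriv ?_
  simp only [id]
  field_simp
  ring

theorem hasDerivAt_IPole (hn : n ≠ 0) {p : ℂ} (hp : ‖p‖ = 1) (hk : ∀ k < n, p ≠ zRoot n k) {z : ℂ}
    (hz : z ∈ unitDisk) :
    HasDerivAt (IPole n p) (1 / (p - z) ^ 2 * (1 / (1 - z ^ n))) z := by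
  have hn0 : (n : ℂ) ≠ 0 := Nat.cast_ne_zero.mpr hn
  have h0 := one_sub_pow_ne_zero hn hz
  have h1 := sub_ne_zero_of_mem_unitDisk hp hz
  unfold IPole
  refine ((HasDerivAt.fun_sum (u := Finset.range n) fun k hkn =>
    hasDerivAt_doublePoleTerm (n := n) (k := k) hp (hk k (Finset.mem_range.mp hkn))
      hz).const_mul (1 / n : ℂ)).neg.congr_deriv ?_
  rw [Finset.sum_neg_distrib, ← Finset.mul_sum, sum_zRoot_div_sub hn hz]
  field_simp

/-- The summand `k = m` has a triple pole `z_m/(z_m - z)³`, whose primitive is the separate rational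
term of `IRoot`. -/
theorem hasDerivAt_IRoot (hn : n ≠ 0) {m : ℕ} (hm : m < n) {z : ℂ} (hz : z ∈ unitDisk) :
    HasDerivAt (IRoot n m) (1 / (zRoot n m - z) ^ 2 * (1 / (1 - z ^ n))) z := by
  have hn0 : (n : ℂ) ≠ 0 := Nat.cast_ne_zero.mpr hn
  have h0 := one_sub_pow_ne_zero hn hz
  have h1 := sub_ne_zero_of_mem_unitDisk (norm_zRoot n m) hz
  have h1' : z - zRoot n m ≠ 0 := by rw [← neg_sub]; exact neg_ne_zero.mpr h1
  have hsum := sum_zRoot_div_sub hn hz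
  rw [← Finset.add_sum_erase _ _ (Finset.mem_range.mpr hm)] at hsum
  unfold IRoot
  refine (((HasDerivAt.fun_sum (u := (Finset.range n).erase m) fun k hkn =>
    hasDerivAt_doublePoleTerm (n := n) (k := k) (norm_zRoot n m) (fun h =>
      Finset.ne_of_mem_erase hkn (zRoot_injOn hn hm
        (Finset.mem_range.mp (Finset.mem_of_mem_erase hkn)) h).symm)
      hz).const_mul (1 / n : ℂ)).neg.add
    ((((hasDerivAt_const z (1 : ℂ)).div (((hasDerivAt_id z).sub_const (zRoot n m)).pow 2)
      (pow_ne_zero 2 h1')).sub_const (1 / zRoot n m ^ 2)).const_mul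
        (zRoot n m / (2 * n)))).congr_deriv ?_
  rw [Finset.sum_neg_distrib, ← Finset.mul_sum, eq_sub_of_add_eq' hsum]
  simp only [id, Pi.pow_apply]
  rw [← neg_sub (zRoot n m) z]
  field_simp
  ring

theorem IOne_zero (n : ℕ) : IOne n 0 = 0 := by
  have h (k : ℕ) : IOneTerm n k 0 = 0 := by simp [IOneTerm, zRoot_ne_zero]
  simp [IOne, IOneZero, IOneHalf, h]

theorem doublePoleTerm_zero (n k : ℕ) {p : ℂ} (hp : p ≠ 0) : doublePoleTerm n k p 0 = 0 := by
  simp [doublePoleTerm, zRoot_ne_zero, hp]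

theorem IPole_zero (n : ℕ) {p : ℂ} (hp : p ≠ 0) : IPole n p 0 = 0 := by
  simp [IPole, doublePoleTerm_zero _ _ hp]

theorem IRoot_zero (n m : ℕ) : IRoot n m 0 = 0 := by
  simp [IRoot, doublePoleTerm_zero _ _ (zRoot_ne_zero n m)]

/-- Only the derivatives of `I₂`, `I₃` and their values at `0` matter, so one argument serves both
the generic and the resonant `γ`. -/
theorem shearH_fourSlit_eq_combineH {A B γ : ℝ} (hγ : γ ∈ Ioo 0 Real.pi) {n : ℕ} (hn : n ≠ 0)
    {I₂ I₃ : ℂ → ℂ} (h2 : I₂ 0 = 0) (h3 : I₃ 0 = 0)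
    (hI₂ : ∀ z ∈ unitDisk,
      HasDerivAt I₂ (1 / (exp (-(I * γ)) - z) ^ 2 * (1 / (1 - z ^ n))) z)
    (hI₃ : ∀ z ∈ unitDisk,
      HasDerivAt I₃ (1 / (exp (I * γ) - z) ^ 2 * (1 / (1 - z ^ n))) z) {z : ℂ}
    (hz : z ∈ unitDisk) :
    shearH (fourSlit A B γ) (fun z => z ^ n) z = combineH A B γ (IOne n z) (I₂ z) (I₃ z) := by
  have hφ := analyticOnNhd_fourSlit A B γ
  have hcont : ContinuousOn (fun ζ => deriv (fourSlit A B γ) ζ / (1 - ζ ^ n)) unitDisk :=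
    hφ.deriv.continuousOn.div (by fun_prop) fun ζ hζ => one_sub_pow_ne_zero hn hζ
  rw [shearH, segmentIntegral_eq_sub (F := fun z => combineH A B γ (IOne n z) (I₂ z) (I₃ z))
    _ hcont hz]
  · simp [combineH, IOne_zero, h2, h3]
  · intro w hw
    have hs : (Real.sin γ : ℂ) ≠ 0 := ofReal_ne_zero.mpr (Real.sin_pos_of_mem_Ioo hγ).ne'
    have e0 := one_sub_pow_ne_zero hn hw
    have e1 := one_sub_mul_ne_zero (norm_exp_I_mul γ) hw
    have e2 := one_sub_mul_ne_zero (norm_exp_neg_I_mul γ) hw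
    have e3 := one_sub_sq_ne_zero hw
    have e4 := sub_ne_zero_of_mem_unitDisk (norm_exp_I_mul γ) hw
    have e5 := sub_ne_zero_of_mem_unitDisk (norm_exp_neg_I_mul γ) hw
    have hab := exp_I_mul_mul_exp_neg γ
    have hsub := exp_I_mul_sub_exp_neg γ
    unfold combineH
    refine (((hasDerivAt_IOne hn hw).const_mul (2 * A : ℂ)).sub
      ((((hI₂ w hw).const_mul (exp (-(I * γ)))).sub ((hI₃ w hw).const_mul
        (exp (I * γ)))).const_mul (B / (2 * Real.sin γ) * I : ℂ))).congr_deriv ?_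
    rw [(hasDerivAt_fourSlit A B γ hw).deriv]
    set a := exp (I * γ)
    set b := exp (-(I * γ))
    have hprod : (1 - a * w) * (1 - b * w) = (a - w) * (b - w) := by
      linear_combination (w ^ 2 - 1) * hab
    have hnum : b * (a - w) ^ 2 - a * (b - w) ^ 2 = 2 * I * Real.sin γ * (1 - w ^ 2) := by
      linear_combination (a - b) * hab + (1 - w ^ 2) * hsub
    -- Partial fractions of the rational part of `φ'`: only pure double poles occur, at `a` and `b`.
    have hpf : b * (1 / (b - w) ^ 2) - a * (1 / (a - w) ^ 2)
        = 2 * I * Real.sin γ * (1 - w ^ 2) / ((a - w) * (b - w)) ^ 2 := by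
      rw [← hnum]
      field_simp
    rw [hprod, ← mul_assoc b, ← mul_assoc a, ← sub_mul, hpf, add_div]
    rw [sub_eq_add_neg]
    congr 1
    · field_simp
    · field_simp
      rw [I_sq]
      ring

end Antiderivatives

/-! ### Functions on a strip whose derivative has negative imaginary part. -/

section Strip

variable {Ψ Ψ' : ℂ → ℂ} {c : ℝ}

theorem add_mul_I_mem_strip {t θ : ℝ} (hθ : θ ∈ Ioo 0 c) :
    (t + θ * I : ℂ) ∈ {s : ℂ | s.im ∈ Ioo 0 c} := by
  simpa using hθ

theorem convex_strip (c : ℝ) : Convex ℝ {s : ℂ | s.im ∈ Ioo 0 c} :=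
  (convex_Ioo 0 c).is_linear_preimage ⟨add_im, fun r z => by simp⟩

/-- A form of the Noshiro-Warschawski theorem. -/
theorem injOn_of_im_deriv_neg {S : Set ℂ} (hS : Convex ℝ S)
    (hΨ : ∀ s ∈ S, HasDerivAt Ψ (Ψ' s) s) (hneg : ∀ s ∈ S, (Ψ' s).im < 0) : InjOn Ψ S := by
  intro s hs w hw hsw
  by_contra hne
  have hd : w - s ≠ 0 := sub_ne_zero.mpr (Ne.symm hne)
  have hmem : ∀ r ∈ Icc (0 : ℝ) 1, s + r * (w - s) ∈ S := fun r hr => by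
    have := hS.add_smul_sub_mem hs hw hr
    rwa [real_smul] at this
  -- Dividing by `w - s` removes the direction of the segment, so the derivative is `Im Ψ'` itself.
  have hder : ∀ r ∈ Icc (0 : ℝ) 1, HasDerivAt (fun r : ℝ => (Ψ (s + r * (w - s)) / (w - s)).im)
      (Ψ' (s + r * (w - s))).im r := by
    intro r hr
    have h1 : HasDerivAt (fun r : ℝ => s + (r : ℂ) * (w - s)) (w - s) r := by
      simpa using ((hasDerivAt_id r).ofReal_comp.mul_const (w - s)).const_add s
    have h2 := ((hΨ _ (hmem r hr)).comp r h1).div_const (w - s)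
    rw [mul_div_cancel_right₀ _ hd] at h2
    exact imCLM.hasFDerivAt.comp_hasDerivAt r h2
  have hanti : StrictAntiOn (fun r : ℝ => (Ψ (s + r * (w - s)) / (w - s)).im) (Icc 0 1) := by
    apply strictAntiOn_of_deriv_neg (convex_Icc 0 1)
    · exact fun r hr => (hder r hr).continuousAt.continuousWithinAt
    · intro r hr
      have hr' := interior_subset hr
      rw [(hder r hr').deriv]
      exact hneg _ (hmem r hr')
  have h3 := hanti (left_mem_Icc.mpr zero_le_one) (right_mem_Icc.mpr zero_le_one) one_pos
  simp [hsw] at h3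

theorem strictAnti_im_of_im_deriv_neg
    (hΨ : ∀ s, s.im ∈ Ioo 0 c → HasDerivAt Ψ (Ψ' s) s) (hneg : ∀ s, s.im ∈ Ioo 0 c → (Ψ' s).im < 0)
    {θ : ℝ} (hθ : θ ∈ Ioo 0 c) : StrictAnti fun t : ℝ => (Ψ (t + θ * I)).im := by
  refine strictAnti_of_hasDerivAt_neg (f' := fun t : ℝ => (Ψ' (t + θ * I)).im) (fun t => ?_)
    fun t => hneg _ (add_mul_I_mem_strip hθ)
  have h1 : HasDerivAt (fun t : ℝ => (t : ℂ) + θ * I) 1 t :=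
    (hasDerivAt_id t).ofReal_comp.add_const _
  have h2 := (hΨ _ (add_mul_I_mem_strip (t := t) hθ)).comp t h1
  rw [mul_one] at h2
  exact imCLM.hasFDerivAt.comp_hasDerivAt t h2

/-- Each horizontal line of the strip meets the level set `Im Ψ = y` in exactly one point, with real
part `τ θ`; the level set is the graph of a continuous `τ` over an interval. -/
theorem isPreconnected_image_strip
    (hΨ : ∀ s, s.im ∈ Ioo 0 c → HasDerivAt Ψ (Ψ' s) s) (hneg : ∀ s, s.im ∈ Ioo 0 c → (Ψ' s).im < 0)
    (hsurj : ∀ θ ∈ Ioo 0 c, ∀ y : ℝ, ∃ t : ℝ, (Ψ (t + θ * I)).im = y) (y : ℝ) :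
    IsPreconnected (Ψ '' {s : ℂ | s.im ∈ Ioo 0 c} ∩ {w : ℂ | w.im = y}) := by
  choose! τ hτ using fun θ hθ => hsurj θ hθ y
  have hcont : ∀ (t : ℝ), ∀ θ ∈ Ioo 0 c, ContinuousAt (fun θ : ℝ => (Ψ (t + θ * I)).im) θ := by
    intro t θ hθ
    have h1 : ContinuousAt (fun θ : ℝ => (t + θ * I : ℂ)) θ := by fun_prop
    exact continuous_im.continuousAt.comp
      (ContinuousAt.comp (hΨ _ (add_mul_I_mem_strip hθ)).continuousAt h1)
  -- The strict inequalities at `τ θ ± ε` persist for nearby heights `η`, and monotonicity then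
  -- traps `τ η` between them.
  have hτc : ContinuousOn τ (Ioo 0 c) := by
    intro θ hθ
    apply ContinuousAt.continuousWithinAt
    rw [Metric.continuousAt_iff']
    intro ε hε
    have hanti := strictAnti_im_of_im_deriv_neg hΨ hneg hθ
    have h1 : (Ψ ((τ θ + ε : ℝ) + θ * I)).im < y := by
      rw [← hτ θ hθ]; exact hanti (lt_add_of_pos_right _ hε)
    have h2 : y < (Ψ ((τ θ - ε : ℝ) + θ * I)).im := by
      conv_lhs => rw [← hτ θ hθ]
      exact hanti (sub_lt_self _ hε)
    filter_upwards [(hcont _ θ hθ).eventually_lt_const h1, (hcont _ θ hθ).eventually_const_lt h2,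
      isOpen_Ioo.mem_nhds hθ] with η h3 h4 hη
    have hanti' := strictAnti_im_of_im_deriv_neg hΨ hneg hη
    rw [← hτ η hη] at h3 h4
    have h5 := hanti'.lt_iff_gt.mp h3
    have h6 := hanti'.lt_iff_gt.mp h4
    rw [Real.dist_eq, abs_lt]
    constructor <;> linarith
  have himage : Ψ '' {s : ℂ | s.im ∈ Ioo 0 c} ∩ {w : ℂ | w.im = y}
      = (fun θ : ℝ => Ψ (τ θ + θ * I)) '' Ioo 0 c := by
    ext w
    constructor
    · rintro ⟨⟨s, hs, rfl⟩, hy⟩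
      refine ⟨s.im, hs, ?_⟩
      have h1 : (Ψ (s.re + s.im * I)).im = y := by rw [re_add_im]; exact hy
      have h2 : τ s.im = s.re := by
        apply (strictAnti_im_of_im_deriv_neg hΨ hneg hs).injective
        simp only [h1]
        exact hτ _ hs
      simp only [h2, re_add_im]
    · rintro ⟨θ, hθ, rfl⟩
      exact ⟨mem_image_of_mem _ (add_mul_I_mem_strip hθ), hτ θ hθ⟩
  rw [himage]
  refine isPreconnected_Ioo.image _ fun θ hθ => ?_
  have h1 : ContinuousWithinAt (fun θ : ℝ => (τ θ + θ * I : ℂ)) (Ioo 0 c) θ :=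
    (continuous_ofReal.continuousAt.comp_continuousWithinAt (hτc θ hθ)).add (by fun_prop)
  exact ContinuousAt.comp_continuousWithinAt
    (hΨ _ (add_mul_I_mem_strip hθ)).continuousAt h1

end Strip

/-! ### The change of variable from the strip to the disk. -/

/-- The involution `W ↦ (a - W) / (1 - a W)`; for `a = e^{iγ}` with `0 < γ < π` it exchanges the
unit disk and the upper half-plane. -/
noncomputable def diskInvolution (a W : ℂ) : ℂ := (a - W) / (1 - a * W)

section Involution

variable {γ : ℝ}

theorem exp_I_mul_re (γ : ℝ) : (exp (I * γ)).re = Real.cos γ := by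
  rw [mul_comm, exp_ofReal_mul_I_re]

theorem exp_I_mul_im (γ : ℝ) : (exp (I * γ)).im = Real.sin γ := by
  rw [mul_comm, exp_ofReal_mul_I_im]

theorem normSq_one_sub_mul_sub_normSq_sub (γ : ℝ) (W : ℂ) :
    normSq (1 - exp (I * γ) * W) - normSq (exp (I * γ) - W) = 4 * Real.sin γ * W.im := by
  simp only [normSq_apply, sub_re, sub_im, mul_re, mul_im, one_re, one_im, exp_I_mul_re,
    exp_I_mul_im]
  linear_combination (W.re ^ 2 + W.im ^ 2 - 1) * Real.sin_sq_add_cos_sq γ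

theorem normSq_sub_lt (hγ : γ ∈ Ioo 0 Real.pi) {W : ℂ} (hW : 0 < W.im) :
    normSq (exp (I * γ) - W) < normSq (1 - exp (I * γ) * W) := by
  have h := normSq_one_sub_mul_sub_normSq_sub γ W
  have h1 := Real.sin_pos_of_mem_Ioo hγ
  have : 0 < 4 * Real.sin γ * W.im := by positivity
  linarith

theorem one_sub_mul_ne_zero_of_im_pos (hγ : γ ∈ Ioo 0 Real.pi) {W : ℂ} (hW : 0 < W.im) :
    1 - exp (I * γ) * W ≠ 0 :=
  normSq_pos.mp ((normSq_nonneg _).trans_lt (normSq_sub_lt hγ hW))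

theorem diskInvolution_mem_unitDisk (hγ : γ ∈ Ioo 0 Real.pi) {W : ℂ} (hW : 0 < W.im) :
    diskInvolution (exp (I * γ)) W ∈ unitDisk := by
  have h := normSq_sub_lt hγ hW
  have h0 := one_sub_mul_ne_zero_of_im_pos hγ hW
  rw [mem_unitDisk, diskInvolution, norm_div, div_lt_one (norm_pos_iff.mpr h0)]
  rw [normSq_eq_norm_sq, normSq_eq_norm_sq] at h
  exact lt_of_pow_lt_pow_left₀ 2 (norm_nonneg _) h

theorem im_diskInvolution_pos (hγ : γ ∈ Ioo 0 Real.pi) {z : ℂ} (hz : z ∈ unitDisk) :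
    0 < (diskInvolution (exp (I * γ)) z).im := by
  have h1 : 0 < normSq (1 - exp (I * γ) * z) :=
    normSq_pos.mpr (one_sub_mul_ne_zero (norm_exp_I_mul γ) hz)
  have h2 : normSq z < 1 := by
    rw [normSq_eq_norm_sq]
    nlinarith [norm_nonneg z, mem_unitDisk.mp hz]
  have h3 := Real.sin_pos_of_mem_Ioo hγ
  rw [diskInvolution, div_im, ← sub_div]
  apply div_pos _ h1
  rw [normSq_apply] at h2
  simp only [sub_re, sub_im, mul_re, mul_im, one_re, one_im, exp_I_mul_re, exp_I_mul_im]
  have h4 : 0 < Real.sin γ * (1 - (z.re * z.re + z.im * z.im)) := by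
    apply mul_pos h3; linarith
  refine h4.trans_eq ?_
  linear_combination (-z.im) * Real.sin_sq_add_cos_sq γ

/-- Up to sign this is the determinant of the Möbius map `diskInvolution`. -/
theorem one_sub_exp_I_mul_sq_ne_zero (hγ : γ ∈ Ioo 0 Real.pi) : 1 - exp (I * γ) ^ 2 ≠ 0 := by
  have hs : (Real.sin γ : ℂ) ≠ 0 := ofReal_ne_zero.mpr (Real.sin_pos_of_mem_Ioo hγ).ne'
  have h : 1 - exp (I * γ) ^ 2 = -(exp (I * γ) * (2 * I * Real.sin γ)) := by
    linear_combination (-exp (I * γ)) * exp_I_mul_sub_exp_neg γ - exp_I_mul_mul_exp_neg γ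
  rw [h, neg_ne_zero]
  exact mul_ne_zero (exp_ne_zero _) (mul_ne_zero (mul_ne_zero two_ne_zero I_ne_zero) hs)

theorem diskInvolution_diskInvolution {a z : ℂ} (ha : 1 - a ^ 2 ≠ 0) (hz : 1 - a * z ≠ 0) :
    diskInvolution a (diskInvolution a z) = z := by
  unfold diskInvolution
  have h1 : a - (a - z) / (1 - a * z) = (1 - a ^ 2) * z / (1 - a * z) := by
    rw [eq_div_iff hz, sub_mul, div_mul_cancel₀ _ hz]; ring
  have h2 : 1 - a * ((a - z) / (1 - a * z)) = (1 - a ^ 2) / (1 - a * z) := by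
    rw [eq_div_iff hz, sub_mul, mul_assoc, div_mul_cancel₀ _ hz]; ring
  rw [h1, h2, div_div_div_cancel_right₀ hz, mul_div_cancel_left₀ _ ha]

theorem hasDerivAt_diskInvolution {a W : ℂ} (h : 1 - a * W ≠ 0) :
    HasDerivAt (diskInvolution a) ((a ^ 2 - 1) / (1 - a * W) ^ 2) W := by
  unfold diskInvolution
  refine (((hasDerivAt_id W).const_sub a).div
    (((hasDerivAt_id W).const_mul a).const_sub 1) h).congr_deriv ?_
  congr 1
  simp only [id]
  ring

theorem im_exp_pos {s : ℂ} (hs : s.im ∈ Ioo 0 Real.pi) : 0 < (exp s).im := by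
  rw [exp_im]
  exact mul_pos (Real.exp_pos _) (Real.sin_pos_of_mem_Ioo hs)

theorem image_strip_diskInvolution_exp (hγ : γ ∈ Ioo 0 Real.pi) :
    (fun s => diskInvolution (exp (I * γ)) (exp s)) '' {s : ℂ | s.im ∈ Ioo 0 Real.pi}
      = unitDisk := by
  ext z
  constructor
  · rintro ⟨s, hs, rfl⟩
    exact diskInvolution_mem_unitDisk hγ (im_exp_pos hs)
  · intro hz
    have h1 := im_diskInvolution_pos hγ hz
    have h2 : diskInvolution (exp (I * γ)) z ≠ 0 := fun h => by simp [h] at h1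
    refine ⟨log (diskInvolution (exp (I * γ)) z), ?_, ?_⟩
    · rw [mem_ofPred_eq, log_im]
      refine ⟨(arg_nonneg_iff.mpr h1.le).lt_of_ne' fun h => ?_,
        (arg_le_pi _).lt_of_ne fun h => ?_⟩
      · exact h1.ne' (arg_eq_zero_iff.mp h).2
      · exact h1.ne' (arg_eq_pi_iff.mp h).2
    · simp only [exp_log h2]
      exact diskInvolution_diskInvolution (one_sub_exp_I_mul_sq_ne_zero hγ)
        (one_sub_mul_ne_zero (norm_exp_I_mul γ) hz)

end Involution

/-! ### The four-slit map in the strip coordinate: injectivity and CHD image. -/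

section FourSlitStrip

variable {A B γ : ℝ}

/-- `fourSlit` in the coordinate of the strip `0 < Im s < π`. -/
noncomputable def fourSlitStrip (A B γ : ℝ) (s : ℂ) : ℂ :=
  fourSlit A B γ (diskInvolution (exp (I * γ)) (exp s))

/-- The coordinate is chosen so that `dz/ds = (1 - az)(1 - bz)/(a - b)`, with `a - b = 2i sin γ`,
which produces exactly the quantity of positive real part. -/
theorem hasDerivAt_fourSlitStrip (hγ : γ ∈ Ioo 0 Real.pi) {s : ℂ} (hs : s.im ∈ Ioo 0 Real.pi) :
    HasDerivAt (fourSlitStrip A B γ)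
      ((fun z => (1 - exp (I * γ) * z) * (1 - exp (-(I * γ)) * z) * deriv (fourSlit A B γ) z)
        (diskInvolution (exp (I * γ)) (exp s)) / (2 * I * Real.sin γ)) s := by
  have hW := im_exp_pos hs
  have h1 := one_sub_mul_ne_zero_of_im_pos hγ hW
  have hz := diskInvolution_mem_unitDisk hγ hW
  have h2 := ((hasDerivAt_fourSlit A B γ hz).differentiableAt.hasDerivAt.comp _
    (hasDerivAt_diskInvolution h1)).comp s (Complex.hasDerivAt_exp s)
  refine h2.congr_deriv ?_
  have hab := exp_I_mul_mul_exp_neg γ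
  have hsub := exp_I_mul_sub_exp_neg γ
  have hs0 : (2 * I * Real.sin γ : ℂ) ≠ 0 := mul_ne_zero (mul_ne_zero two_ne_zero I_ne_zero)
    (ofReal_ne_zero.mpr (Real.sin_pos_of_mem_Ioo hγ).ne')
  rw [← hsub] at hs0 ⊢
  set a := exp (I * γ)
  set b := exp (-(I * γ))
  set W := exp s
  set z := diskInvolution a W with hzdef
  have e1 : 1 - a * z = (1 - a ^ 2) / (1 - a * W) := by
    rw [hzdef, diskInvolution, eq_div_iff h1, sub_mul, mul_assoc, div_mul_cancel₀ _ h1]; ring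
  have e2 : 1 - b * z = (b - a) * W / (1 - a * W) := by
    rw [hzdef, diskInvolution, eq_div_iff h1, sub_mul, mul_assoc, div_mul_cancel₀ _ h1]
    linear_combination -hab
  simp only [e1, e2]
  rw [eq_div_iff hs0]
  field_simp
  ring

theorem im_deriv_fourSlitStrip_neg (hA : 0 < A) (hB : 0 < B) (hγ : γ ∈ Ioo 0 Real.pi) {s : ℂ}
    (hs : s.im ∈ Ioo 0 Real.pi) :
    ((fun z => (1 - exp (I * γ) * z) * (1 - exp (-(I * γ)) * z) * deriv (fourSlit A B γ) z)
        (diskInvolution (exp (I * γ)) (exp s)) / (2 * I * Real.sin γ)).im < 0 := by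
  have h1 := re_mul_deriv_fourSlit_pos hA hB γ (diskInvolution_mem_unitDisk hγ (im_exp_pos hs))
  have h2 := Real.sin_pos_of_mem_Ioo hγ
  simp only
  set Q := (1 - exp (I * γ) * diskInvolution (exp (I * γ)) (exp s)) *
    (1 - exp (-(I * γ)) * diskInvolution (exp (I * γ)) (exp s)) *
    deriv (fourSlit A B γ) (diskInvolution (exp (I * γ)) (exp s))
  clear_value Q
  generalize Real.sin γ = σ at h2 ⊢
  have h3 : Q / (2 * I * σ) = ((-(1 / (2 * σ)) : ℝ) : ℂ) * (I * Q) := by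
    have hs0 : (σ : ℂ) ≠ 0 := ofReal_ne_zero.mpr h2.ne'
    have hI := I_ne_zero
    push_cast
    field_simp
    linear_combination Q * I_sq
  rw [h3, im_ofReal_mul, I_mul_im]
  have : 0 < 1 / (2 * σ) * Q.re := by positivity
  linarith

/-- The argument `w` may stay unspecified: only the bound `|arg w| ≤ π` is needed later. -/
theorem fourSlitStrip_eq (A B : ℝ) (hγ : γ ∈ Ioo 0 Real.pi) {s : ℂ} (hs : s.im ∈ Ioo 0 Real.pi) :
    ∃ w : ℂ, fourSlitStrip A B γ s = (A : ℂ) * log w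
      + ((B / (4 * Real.sin γ ^ 2) : ℝ) : ℂ) * ((2 * Real.cos γ : ℝ) - exp s - exp (-s)) := by
  refine ⟨_, congrArg₂ (· + ·) rfl ?_⟩
  have h1 := one_sub_mul_ne_zero_of_im_pos hγ (im_exp_pos hs)
  have hs0 : (Real.sin γ : ℂ) ≠ 0 := ofReal_ne_zero.mpr (Real.sin_pos_of_mem_Ioo hγ).ne'
  have hsub := exp_I_mul_sub_exp_neg γ
  have hab := exp_I_mul_mul_exp_neg γ
  have hcos : exp (I * γ) + exp (-(I * γ)) = (2 * Real.cos γ : ℝ) := by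
    push_cast
    rw [Complex.cos, mul_comm I, neg_mul]
    ring
  have hsq := one_sub_exp_I_mul_sq_ne_zero hγ
  have hW0 := exp_ne_zero s
  have hba : exp (-(I * γ)) - exp (I * γ) ≠ 0 := by
    rw [← neg_sub, hsub, neg_ne_zero]
    exact mul_ne_zero (mul_ne_zero two_ne_zero I_ne_zero) hs0
  rw [← hcos, Complex.exp_neg s]
  have hsin : (4 * Real.sin γ ^ 2 : ℂ) = -(exp (-(I * γ)) - exp (I * γ)) ^ 2 := by
    linear_combination (-2 * I * Real.sin γ - exp (I * γ) + exp (-(I * γ))) * (-hsub)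
      + 4 * (Real.sin γ : ℂ) ^ 2 * I_sq
  push_cast
  rw [← ofReal_sin, hsin]
  set a := exp (I * γ)
  set b := exp (-(I * γ))
  set W := exp s
  have e1 : 1 - a * diskInvolution a W = (1 - a ^ 2) / (1 - a * W) := by
    rw [diskInvolution, eq_div_iff h1, sub_mul, mul_assoc, div_mul_cancel₀ _ h1]; ring
  have e2 : 1 - b * diskInvolution a W = (b - a) * W / (1 - a * W) := by
    rw [diskInvolution, eq_div_iff h1, sub_mul, mul_assoc, div_mul_cancel₀ _ h1]
    linear_combination -hab
  have e3 : 1 - a ^ 2 = a * (b - a) := by linear_combination -hab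
  have ha0 : a ≠ 0 := exp_ne_zero _
  rw [e1, e2, diskInvolution, e3]
  field_simp
  linear_combination (B * W) * hab

theorem exists_im_fourSlitStrip_eq (hA : 0 < A) (hB : 0 < B) (hγ : γ ∈ Ioo 0 Real.pi) {θ : ℝ}
    (hθ : θ ∈ Ioo 0 Real.pi) (y : ℝ) : ∃ t : ℝ, (fourSlitStrip A B γ (t + θ * I)).im = y := by
  have hcont : Continuous fun t : ℝ => (fourSlitStrip A B γ (t + θ * I)).im := by
    refine continuous_iff_continuousAt.mpr fun t => continuous_im.continuousAt.comp ?_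
    have h1 : ContinuousAt (fun t : ℝ => (t + θ * I : ℂ)) t := by fun_prop
    exact ContinuousAt.comp (g := fourSlitStrip A B γ) (hasDerivAt_fourSlitStrip hγ (add_mul_I_mem_strip hθ)).continuousAt
      h1
  have hγs := Real.sin_pos_of_mem_Ioo hγ
  have hθs := Real.sin_pos_of_mem_Ioo hθ
  -- On `Im s = θ` one has `Im(e^s + e^{-s}) = 2 sin θ sinh t`, so `-c sinh t` is the imaginary part
  -- of the non-logarithmic term.
  set c : ℝ := B / (4 * Real.sin γ ^ 2) * (2 * Real.sin θ) with hc
  have hcpos : 0 < c := by positivity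
  have hbound : ∀ t : ℝ, |(fourSlitStrip A B γ (t + θ * I)).im + c * Real.sinh t|
      ≤ A * Real.pi := by
    intro t
    obtain ⟨w, hw⟩ := fourSlitStrip_eq A B hγ (add_mul_I_mem_strip (t := t) hθ)
    have h1 : (fourSlitStrip A B γ (t + θ * I)).im + c * Real.sinh t = A * arg w := by
      rw [hw, add_im, im_ofReal_mul, im_ofReal_mul, log_im, sub_im, sub_im, ofReal_im, exp_im,
        exp_im, hc, Real.sinh_eq]
      simp
      ring
    rw [h1, abs_mul, abs_of_pos hA]
    exact mul_le_mul_of_nonneg_left (abs_arg_le_pi w) hA.le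
  refine mem_range_of_exists_le_of_exists_ge hcont ?_ ?_
  -- Here `c sinh t = Aπ - y`, so the bound gives a value at most `y`; the other choice gives one at
  -- least `y`.
  · obtain ⟨t, ht⟩ := Real.sinh_surjective ((A * Real.pi - y) / c)
    refine ⟨t, ?_⟩
    have h1 := (abs_le.mp (hbound t)).2
    rw [ht, mul_div_cancel₀ _ hcpos.ne'] at h1
    linarith
  · obtain ⟨t, ht⟩ := Real.sinh_surjective ((-(A * Real.pi) - y) / c)
    refine ⟨t, ?_⟩
    have h1 := (abs_le.mp (hbound t)).1
    rw [ht, mul_div_cancel₀ _ hcpos.ne'] at h1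
    linarith

theorem image_fourSlit_unitDisk (A B : ℝ) (hγ : γ ∈ Ioo 0 Real.pi) :
    fourSlit A B γ '' unitDisk = fourSlitStrip A B γ '' {s : ℂ | s.im ∈ Ioo 0 Real.pi} := by
  rw [← image_strip_diskInvolution_exp hγ, image_image]
  rfl

theorem injOn_fourSlit (hA : 0 < A) (hB : 0 < B) (hγ : γ ∈ Ioo 0 Real.pi) :
    InjOn (fourSlit A B γ) unitDisk := by
  have hinj := injOn_of_im_deriv_neg (convex_strip Real.pi)
    (fun s hs => hasDerivAt_fourSlitStrip (A := A) (B := B) hγ hs)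
    fun s hs => im_deriv_fourSlitStrip_neg hA hB hγ hs
  rw [← image_strip_diskInvolution_exp hγ]
  rintro _ ⟨s, hs, rfl⟩ _ ⟨w, hw, rfl⟩ hsw
  rw [hinj hs hw hsw]

theorem isConnected_unitDisk : IsConnected unitDisk :=
  ⟨⟨0, zero_mem_unitDisk⟩, convex_unitDisk.isPreconnected⟩

theorem isCHDDomain_image_fourSlit (hA : 0 < A) (hB : 0 < B) (hγ : γ ∈ Ioo 0 Real.pi) :
    IsCHDDomain (fourSlit A B γ '' unitDisk) := by
  have hφ := analyticOnNhd_fourSlit A B γ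
  refine ⟨?_, isConnected_unitDisk.image _ hφ.continuousOn, fun y => ?_⟩
  · simpa using isOpen_image_add_conj isOpen_unitDisk hφ (analyticOnNhd_const (v := 0))
      fun z hz => by simpa using deriv_fourSlit_ne_zero hA hB γ hz
  · rw [image_fourSlit_unitDisk A B hγ]
    exact isPreconnected_image_strip (fun s hs => hasDerivAt_fourSlitStrip hγ hs)
      (fun s hs => im_deriv_fourSlitStrip_neg hA hB hγ hs)
      (fun θ hθ => exists_im_fourSlitStrip_eq hA hB hγ hθ) y

end FourSlitStrip

/-! ### Resonant angles and the main theorem. -/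

theorem exists_eq_of_exp_I_mul_pow_eq_one {γ : ℝ} (hγ : γ ∈ Ioo 0 Real.pi) {n : ℕ} (hn : n ≠ 0)
    (h : exp (I * γ) ^ n = 1) : ∃ k < n, γ = 2 * Real.pi * k / n := by
  have hnR : (0 : ℝ) < n := Nat.cast_pos.mpr (Nat.pos_of_ne_zero hn)
  rw [← Complex.exp_nat_mul, Complex.exp_eq_one_iff] at h
  obtain ⟨m, hm⟩ := h
  have h1 : (n : ℝ) * γ = m * (2 * Real.pi) := by
    have h2 : ((n : ℂ) * γ) = m * (2 * Real.pi) := by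
      apply mul_left_cancel₀ I_ne_zero
      linear_combination hm
    exact_mod_cast h2
  have hpi := Real.pi_pos
  have hm0 : (0 : ℝ) < m := by
    have : 0 < (m : ℝ) * (2 * Real.pi) := h1 ▸ mul_pos hnR hγ.1
    exact pos_of_mul_pos_left this (by positivity)
  have hmn : (m : ℝ) < n := by
    have h3 : (m : ℝ) * (2 * Real.pi) < n * (2 * Real.pi) :=
      h1 ▸ mul_lt_mul_of_pos_left (by linarith [hγ.2]) hnR
    exact lt_of_mul_lt_mul_right h3 (by positivity)
  lift m to ℕ using (by exact_mod_cast hm0.le)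
  refine ⟨m, by exact_mod_cast hmn, ?_⟩
  rw [eq_div_iff hnR.ne', mul_comm γ, h1, mul_comm, Int.cast_natCast]

theorem mainTheorem1 (A B γ : ℝ) (n : ℕ) (hA : 0 < A) (hB : 0 < B)
    (hγ : γ ∈ Set.Ioo 0 Real.pi) (hn : 1 ≤ n)
    (φ ω h g f : ℂ → ℂ) (hφ : φ = fourSlit A B γ) (hω : ω = fun z => z ^ n)
    (hh : h = shearH φ ω) (hg : g = shearG φ ω) (hf : f = fun z => h z + conj (g z)) :
    -- the map being sheared is a conformal map onto a CHD domain
    (AnalyticOnNhd ℂ φ unitDisk ∧ Set.InjOn φ unitDisk ∧ IsCHDDomain (φ '' unitDisk)) ∧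
    -- `h`, `g` solve the shear equations with dilatation `z ^ n`
    SolvesShearEquations φ ω h g ∧
    -- explicit formula for `h`, when `γ` is not of the form `2πm/n`
    ((∀ m < n, γ ≠ 2 * Real.pi * m / n) → ∀ z ∈ unitDisk,
      h z = combineH A B γ (IOne n z)
        (IPole n (exp (-(I * γ))) z) (IPole n (exp (I * γ)) z)) ∧
    -- explicit formula for `h`, when `γ = 2πm/n`
    (∀ m < n, γ = 2 * Real.pi * m / n → ∀ z ∈ unitDisk,
      h z = combineH A B γ (IOne n z) (IRoot n (n - m) z) (IRoot n m z)) ∧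
    (∀ z ∈ unitDisk, g z = h z - φ z) ∧
    -- `f` is harmonic and maps the unit disk univalently onto a CHD domain
    InnerProductSpace.HarmonicOnNhd f unitDisk ∧
    Set.InjOn f unitDisk ∧ IsCHDDomain (f '' unitDisk) := by
  have hn0 : n ≠ 0 := Nat.one_le_iff_ne_zero.mp hn
  have hφa : AnalyticOnNhd ℂ φ unitDisk := hφ ▸ analyticOnNhd_fourSlit A B γ
  have hφi : InjOn φ unitDisk := hφ ▸ injOn_fourSlit hA hB hγ
  have hφc : IsCHDDomain (φ '' unitDisk) := hφ ▸ isCHDDomain_image_fourSlit hA hB hγ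
  have hφ' : ∀ z ∈ unitDisk, deriv φ z ≠ 0 := fun z hz => hφ ▸ deriv_fourSlit_ne_zero hA hB γ hz
  have hωd : DifferentiableOn ℂ ω unitDisk := by rw [hω]; fun_prop
  have hω1 : ∀ z ∈ unitDisk, ‖ω z‖ < 1 := fun z hz => by
    rw [hω, norm_pow]
    exact pow_lt_one₀ (norm_nonneg z) (mem_unitDisk.mp hz) hn0
  have hsolve : SolvesShearEquations φ ω h g := by
    rw [hh, hg]; exact solvesShearEquations_shear hφa hφ' hωd hω1
  have hghφ : ∀ z ∈ unitDisk, g z = h z - φ z := fun z hz => by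
    have h1 := shearH_sub_shearG hφa (by rw [hφ, fourSlit_zero]) hωd hω1 hz
    rw [hg, hh, ← h1, sub_sub_cancel]
  have hgd : ∀ z ∈ unitDisk, HasDerivAt g (ω z * (deriv φ z / (1 - ω z))) z := fun z hz =>
    hg ▸ hasDerivAt_shearG hφa hωd hω1 hz
  obtain ⟨hfi, hfc⟩ := injOn_and_preconnected_of_shear (g := g) (f := f) isOpen_unitDisk hφa hφ' hφi
    hφc.2.2 hω1 hgd fun z hz => by
      -- From `h = φ + g` one gets `h + conj g = φ + 2 Re g`.
      rw [hf, ← add_conj]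
      linear_combination -hghφ z hz
  have hopen : IsOpen (f '' unitDisk) := by
    rw [hf]
    refine isOpen_image_add_conj isOpen_unitDisk hsolve.analytic_h hsolve.analytic_g fun z hz => ?_
    rw [← sub_eq_zero.mp (hsolve.dilatation z hz), norm_mul]
    exact mul_lt_of_lt_one_left (norm_pos_iff.mpr (hsolve.deriv_ne_zero z hz)) (hω1 z hz)
  have hharm : InnerProductSpace.HarmonicOnNhd f unitDisk :=
    hf ▸ harmonicOnNhd_add_conj hsolve.analytic_h hsolve.analytic_g
  refine ⟨⟨hφa, hφi, hφc⟩, hsolve, fun hm z hz => ?_, fun m hmn hm z hz => ?_, hghφ, hharm, hfi,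
    hopen, isConnected_unitDisk.image f fun z hz => (hharm z hz).1.continuousAt.continuousWithinAt,
    hfc⟩
  · have ha : exp (I * γ) ^ n ≠ 1 := fun h1 => by
      obtain ⟨k, hk, h2⟩ := exists_eq_of_exp_I_mul_pow_eq_one hγ hn0 h1
      exact hm k hk h2
    have hb : exp (-(I * γ)) ^ n ≠ 1 := by rwa [Complex.exp_neg, inv_pow, ne_eq, inv_eq_one]
    rw [hh, hφ, hω]
    exact shearH_fourSlit_eq_combineH hγ hn0 (IPole_zero n (exp_ne_zero _))
      (IPole_zero n (exp_ne_zero _))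
      (fun w hw => hasDerivAt_IPole hn0 (norm_exp_neg_I_mul γ)
        (fun k _ h1 => hb (h1 ▸ zRoot_pow hn0 k)) hw)
      (fun w hw => hasDerivAt_IPole hn0 (norm_exp_I_mul γ)
        (fun k _ h1 => ha (h1 ▸ zRoot_pow hn0 k)) hw) hz
  -- Positivity of `m` ensures `n - m < n`, so that `n - m` is an admissible index for the conjugate
  -- root.
  · have hm0 : 0 < m := Nat.pos_of_ne_zero fun h0 => by
      rw [h0, Nat.cast_zero, mul_zero, zero_div] at hm
      exact hγ.1.ne' hm
    have ha : exp (I * γ) = zRoot n m := by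
      rw [zRoot, hm]
      push_cast
      congr 1
      ring
    have hb : exp (-(I * γ)) = zRoot n (n - m) := by
      rw [Complex.exp_neg, ha]
      apply inv_eq_of_mul_eq_one_right
      rw [zRoot_eq_pow, zRoot_eq_pow, ← pow_add, Nat.add_sub_cancel' hmn.le,
        (isPrimitiveRoot_exp n hn0).pow_eq_one]
    rw [hh, hφ, hω]
    exact shearH_fourSlit_eq_combineH hγ hn0 (IRoot_zero n _) (IRoot_zero n _)
      (fun w hw => hb ▸ hasDerivAt_IRoot hn0 (Nat.sub_lt hn hm0) hw)
      (fun w hw => ha ▸ hasDerivAt_IRoot hn0 hmn hw) hz
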